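/- Let $H$ be a complex Hilbert space and write operators on $\mathbb C^2\otimes H=H\oplus H$ as $2\times2$ block matrices. For a bounded operator $A$ on $H$ and $t\in\mathbb R$ put $\mathcal B_A(t)=\exp\left(it\begin{bmatrix}0&A\\A^\dagger&0\end{bmatrix}\right)$, and let $X=\begin{bmatrix}0&1\\1&0\end{bmatrix}$, $S=\begin{bmatrix}1&0\\0&i\end{bmatrix}$ act on the qubit. For families $U,V$ of operators indexed by time, let $\mathrm{BCH}_1(t)=U(t)V(t)U(-t)V(-t)$ and, for $p\ge1$, $$\mathrm{BCH}_{p+1}(t)=\mathrm{BCH}_p(\gamma_pt)\,\mathrm{BCH}_p(-\gamma_pt)\,\mathrm{BCH}_p(\beta_pt)^{-1}\,\mathrm{BCH}_p(-\beta_pt)^{-1}\,\mathrm{BCH}_p(\gamma_pt)\,\mathrm{BCH}_p(-\gamma_pt),$$ where $\beta_p=(2r_p)^{1/2}$, $\gamma_p=(\tfrac14+r_p)^{1/2}$, $r_p=\dfrac{2^{2/(2p+2)}}{4\,(2-2^{2/(2p+2)})}$, and the inverse of a product of exponentials is the product in reverse order with all times negated; we write $\mathrm{BCH}_p(U(t),V(t))$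 for $\mathrm{BCH}_p(t)$. Let $p_A,p_B\ge1$ be real, $q=\max\left(\left\lceil\frac{\min(p_A,p_B)-1}{2}\right\rceil,1\right)$, and for families $\widetilde{\mathcal B}_A,\widetilde{\mathcal B}_B$ of bounded operators on $H\oplus H$ and $t>0$ let $$\mathrm{MULT}(\widetilde{\mathcal B}_A,\widetilde{\mathcal B}_B)(t)=\mathrm{BCH}_q\left(S\,\widetilde{\mathcal B}_A(\tau)\,S^\dagger,\;X\,\widetilde{\mathcal B}_B(\tau)\,X\right),\qquad \tau=\sqrt{t/2}.$$ Then MULT uses at most $8\cdot6^{q-1}$ exponentials (applications of the two encodings). Moreover, for all constants $K_A,K_B$ there are $K$ and $\delta>0$, depending only on $p_A,p_B,K_A,K_B$, such that the following holds for all $H$, all bounded $A,B$ on $H$ with $AB=(AB)^\dagger$, all $c\ge0$ and $t_0>0$, and all families $\widetilde{\mathcal B}_A,\widetilde{\mathcal B}_B$ with $$\|\widetilde{\mathcal B}_A(t)-\mathcal B_A(t)\|\le K_A(ct)^{p_A},\qquad \|\widetilde{\mathcal B}_B(t)-\mathcal B_B(t)\|\le K_B(ct)^{p_B}\qquad(0<t<t_0),$$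 where, for each such $t$, the backward operator $\widetilde{\mathcal B}_A(-t)$ is either the inverse of $\widetilde{\mathcal B}_A(t)$ or approximates $\mathcal B_A(-t)$ with error at most $K_A(ct)^{p_A}$, and likewise for $B$. With $C=\max(\|A\|,\|B\|,c)$, for all $t>0$ with $t\le\delta t_0^2$ and $C^2t\le\delta$, $$\left\|\mathrm{MULT}(\widetilde{\mathcal B}_A,\widetilde{\mathcal B}_B)(t)-\exp\left(it\begin{bmatrix}AB&0\\0&-\tfrac12\left(BA+(BA)^\dagger\right)\end{bmatrix}\right)\right\|\le K\,(C^2t)^{\min(p_A,p_B)/2}.$$ -/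

import Mathlib

noncomputable section

namespace HybridMult

universe u

variable {H : Type u} [NormedAddCommGroup H] [InnerProductSpace ℂ H]

/-- The space `ℂ² ⊗ H` of a qubit and a mode, as the Hilbert sum `H ⊕ H`; the first summand
belongs to the qubit state `|0⟩` and the second one to `|1⟩`. -/
abbrev QubitMode (H : Type u) [NormedAddCommGroup H] [InnerProductSpace ℂ H] : Type u :=
  WithLp 2 (H × H)

/-- The bounded operators on `ℂ² ⊗ H`, with the operator norm. -/
abbrev Op (H : Type u) [NormedAddCommGroup H] [InnerProductSpace ℂ H] : Type u :=
  QubitMode H →L[ℂ] QubitMode H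

/-- The operator with block matrix `[P, Q; R, T]`. -/
def blockOp (P Q R T : H →L[ℂ] H) : Op H :=
  ((WithLp.prodContinuousLinearEquiv 2 ℂ H H).symm : (H × H) →L[ℂ] QubitMode H) ∘L
    ((P ∘L ContinuousLinearMap.fst ℂ H H + Q ∘L ContinuousLinearMap.snd ℂ H H).prod
      (R ∘L ContinuousLinearMap.fst ℂ H H + T ∘L ContinuousLinearMap.snd ℂ H H)) ∘L
    ((WithLp.prodContinuousLinearEquiv 2 ℂ H H) : QubitMode H →L[ℂ] (H × H))

/-- The qubit gate `X`, that is `[0, 1; 1, 0]`. -/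
def gateX : Op H := blockOp 0 1 1 0

/-- The qubit phase gate `S`, that is `[1, 0; 0, i]`. -/
def gateS : Op H := blockOp 1 0 0 (Complex.I • (1 : H →L[ℂ] H))

/-- The exact block encoding `exp (i t [0, A; A†, 0])`. -/
def blockEnc [CompleteSpace H] (A : H →L[ℂ] H) (t : ℝ) : Op H :=
  NormedSpace.exp ((Complex.I * (t : ℂ)) • blockOp 0 A (ContinuousLinearMap.adjoint A) 0)

/-- The target `exp (i t [AB, 0; 0, -(BA + (BA)†)/2])`. -/
def multTarget [CompleteSpace H] (A B : H →L[ℂ] H) (t : ℝ) : Op H :=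
  NormedSpace.exp ((Complex.I * (t : ℂ)) •
    blockOp (A * B) 0 0 (-((1 / 2 : ℂ) • (B * A + ContinuousLinearMap.adjoint (B * A)))))

/-- The two generators fed to a BCH formula. -/
inductive Gen : Type
  | fst : Gen
  | snd : Gen

/-- A product of exponentials, written as a list: the entry `(g, s)` stands for the exponential
of `s` times the generator `g`, with a real, possibly negative, time `s`. -/
abbrev ExpWord : Type := List (Gen × ℝ)

/-- The formal inverse: the exponentials in reverse order with reversed times. -/
def ExpWord.inv (w : ExpWord) : ExpWord := w.reverse.map fun x => (x.1, -x.2)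

/-- `r_p = 2^(2/(2p+2)) / (4 (2 - 2^(2/(2p+2))))`. -/
def bchR (p : ℕ) : ℝ :=
  (2 : ℝ) ^ (2 / (2 * (p : ℝ) + 2)) / (4 * (2 - (2 : ℝ) ^ (2 / (2 * (p : ℝ) + 2))))

/-- `β_p = (2 r_p)^(1/2)`. -/
def bchBeta (p : ℕ) : ℝ := Real.sqrt (2 * bchR p)

/-- `γ_p = (1/4 + r_p)^(1/2)`. -/
def bchGamma (p : ℕ) : ℝ := Real.sqrt (1 / 4 + bchR p)

/-- The recursive BCH (commutator) product formula `BCH_p` of order `p ≥ 1` at time `t`: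
`BCH_1(t) = e^{tY} e^{tZ} e^{-tY} e^{-tZ}` and
`BCH_{p+1}(t) = BCH_p(γ_p t) BCH_p(-γ_p t) BCH_p(β_p t)⁻¹ BCH_p(-β_p t)⁻¹
  BCH_p(γ_p t) BCH_p(-γ_p t)`.
(There is no formula of order `0`; the value there is not used.) -/
def bchWord : ℕ → ℝ → ExpWord
  | 0, _ => []
  | 1, t => [(Gen.fst, t), (Gen.snd, t), (Gen.fst, -t), (Gen.snd, -t)]
  | p + 2, t =>
      bchWord (p + 1) (bchGamma (p + 1) * t) ++ bchWord (p + 1) (-(bchGamma (p + 1) * t)) ++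
      (bchWord (p + 1) (bchBeta (p + 1) * t)).inv ++
      (bchWord (p + 1) (-(bchBeta (p + 1) * t))).inv ++
      bchWord (p + 1) (bchGamma (p + 1) * t) ++ bchWord (p + 1) (-(bchGamma (p + 1) * t))

/-- The product that a word describes when the exponential of `s` times the first (second)
generator is implemented by the operator `U s` (by `V s`). -/
def ExpWord.run {M : Type*} [Monoid M] (w : ExpWord) (U V : ℝ → M) : M :=
  (w.map fun x => match x.1 with
    | Gen.fst => U x.2
    | Gen.snd => V x.2).prod

/-- The order `q = max (⌈(min (p_A, p_B) - 1) / 2⌉, 1)` of the BCH formula in `MULT`. -/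
def multOrder (pA pB : ℝ) : ℕ := max ⌈(min pA pB - 1) / 2⌉₊ 1

/-- The sequence of exponentials of `MULT`: the word of `BCH_q` at time `τ = √(t/2)`. -/
def multWord (pA pB t : ℝ) : ExpWord := bchWord (multOrder pA pB) (Real.sqrt (t / 2))

/-- `MULT = BCH_q (S Ũ_A(τ) S†, X Ũ_B(τ) X)` with `τ = √(t/2)`. -/
def mult [CompleteSpace H] (UA UB : ℝ → Op H) (pA pB t : ℝ) : Op H :=
  (multWord pA pB t).run
    (fun s => gateS * UA s * ContinuousLinearMap.adjoint gateS)
    (fun s => gateX * UB s * gateX)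

/-- `U` approximates the block encoding of `A` with error at most `K (c t)^p` for `0 < t < t₀`.
Exponentials run backwards, `U (-t)` with `t > 0`, are implemented either by the inverse of the
operator `U t`, or by an operator with the same error bound of its own. -/
def ApproxEnc [CompleteSpace H] (U : ℝ → Op H) (A : H →L[ℂ] H) (K c p t₀ : ℝ) : Prop :=
  ∀ t : ℝ, 0 < t → t < t₀ →
    ‖U t - blockEnc A t‖ ≤ K * (c * t) ^ p ∧
    ((U (-t) * U t = 1 ∧ U t * U (-t) = 1) ∨
      ‖U (-t) - blockEnc A (-t)‖ ≤ K * (c * t) ^ p)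

end HybridMult

end

/-! Conjugation by `S` and by `X` turns the two encodings into one-parameter groups `exp (a Y)` and
`exp (a Z)` with skew-adjoint generators `Y = genFst A`, `Z = genSnd B`. When `AB` is self-adjoint,
`τ² [Y, Z]` with `τ² = t/2` is exactly the exponent of the target (`multTarget_eq`), so `MULT` is a
product formula for the exponential of a commutator.

Exact encodings: as formal power series in the time, `BCH_p` agrees with `exp (X² [Y, Z])` through
degree `2p` (`coeff_bchWord`). In the induction, `W(X) W(-X)` kills the odd leading error, and the
weights `γ_p`, `β_p` then kill the next, even one (`near_bchWord_succ`). Bounds on coefficients make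
this quantitative with constants that do not depend on the operators: the error is at most `4 (L C
τ)^(2p+1)` (`norm_bchWord_sub_exp_le`).

Approximate encodings: the exact factors are contractions, so replacing them one at a time costs a
constant times the worst single error (`ExpWord.norm_run_sub_run_le`). An inverse at most doubles
that error (`norm_inv_sub_inv_le`). As `2q + 1 ≥ min pA pB`, both contributions have order `(L C
τ)^(min pA pB)`. -/

namespace HybridMult

open PowerSeries Finset.HasAntidiagonal
open scoped Nat

/-! ### Formal power series compared up to their leading difference -/

section Series

variable {𝔸 : Type*} [Ring 𝔸]

/-- Two power series with constant coefficient `1` which agree below degree `M` and differ by `d`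
in degree `M`. -/
structure Near (M : ℕ) (f g : 𝔸⟦X⟧) (d : 𝔸) : Prop where
  left : coeff 0 f = 1
  right : coeff 0 g = 1
  below : ∀ n < M, coeff n f = coeff n g
  top : coeff M f - coeff M g = d

lemma coeff_mul_of_vanish_left {M : ℕ} {r : 𝔸⟦X⟧} (hr : ∀ n < M, coeff n r = 0) (g : 𝔸⟦X⟧) :
    (∀ n < M, coeff n (r * g) = 0) ∧ coeff M (r * g) = coeff M r * coeff 0 g := by
  refine ⟨fun n hn => ?_, ?_⟩
  · rw [coeff_mul]
    refine Finset.sum_eq_zero fun p hp => ?_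
    rw [mem_antidiagonal] at hp
    rw [hr p.1 (by omega), zero_mul]
  · rw [coeff_mul, Finset.sum_eq_single (M, 0)]
    · rintro ⟨i, j⟩ hp hne
      rw [mem_antidiagonal] at hp
      rw [hr i ?_, zero_mul]
      rcases Nat.lt_or_ge i M with h | h
      · exact h
      · refine (hne ?_).elim
        simp only at hp
        simp only [Prod.mk.injEq]; omega
    · simp

lemma coeff_mul_of_vanish_right {M : ℕ} {r : 𝔸⟦X⟧} (hr : ∀ n < M, coeff n r = 0) (g : 𝔸⟦X⟧) :
    (∀ n < M, coeff n (g * r) = 0) ∧ coeff M (g * r) = coeff 0 g * coeff M r := by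
  refine ⟨fun n hn => ?_, ?_⟩
  · rw [coeff_mul]
    refine Finset.sum_eq_zero fun p hp => ?_
    rw [mem_antidiagonal] at hp
    rw [hr p.2 (by omega), mul_zero]
  · rw [coeff_mul, Finset.sum_eq_single (0, M)]
    · rintro ⟨i, j⟩ hp hne
      rw [mem_antidiagonal] at hp
      rw [hr j ?_, mul_zero]
      rcases Nat.lt_or_ge j M with h | h
      · exact h
      · refine (hne ?_).elim
        simp only at hp
        simp only [Prod.mk.injEq]; omega
    · simp

namespace Near

variable {M : ℕ} {f f' g g' : 𝔸⟦X⟧} {d e : 𝔸}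

lemma vanish (h : Near M f g d) : ∀ n < M, coeff n (f - g) = 0 := fun n hn => by
  rw [map_sub, h.below n hn, sub_self]

/-- Telescope `fg - f'g' = (f - f')g + f'(g - g')`; since constant coefficients are `1`, leading
differences simply add, even without commutativity. -/
lemma mul (h : Near M f f' d) (h' : Near M g g' e) : Near M (f * g) (f' * g') (d + e) := by
  have key : f * g - f' * g' = (f - f') * g + f' * (g - g') := by noncomm_ring
  have h1 := coeff_mul_of_vanish_left h.vanish g
  have h2 := coeff_mul_of_vanish_right h'.vanish f'
  refine ⟨by simp [coeff_mul, h.left, h'.left], by simp [coeff_mul, h.right, h'.right],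
    fun n hn => ?_, ?_⟩
  · rw [← sub_eq_zero, ← map_sub, key, map_add, h1.1 n hn, h2.1 n hn, add_zero]
  · rw [← map_sub, key, map_add, h1.2, h2.2, h'.left, h.right, mul_one, one_mul, map_sub, map_sub,
      h.top, h'.top]

/-- One-sided inverses suffice, because `g - g' = -g (f - f') g'`. -/
lemma inv (h : Near M f f' d) (hg : g * f = 1) (hg' : f' * g' = 1) : Near M g g' (-d) := by
  have key : g - g' = g * (-(f - f') * g') := by
    have : g * (-(f - f') * g') = g * (f' * g') - (g * f) * g' := by noncomm_ring
    rw [this, hg, hg', mul_one, one_mul]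
  have g0 : coeff 0 g = 1 := by
    have := congrArg (coeff 0) hg
    simpa [coeff_mul, h.left] using this
  have g0' : coeff 0 g' = 1 := by
    have := congrArg (coeff 0) hg'
    simpa [coeff_mul, h.right] using this
  have hv : ∀ n < M, coeff n (-(f - f')) = 0 := fun n hn => by
    rw [map_neg, h.vanish n hn, neg_zero]
  have h1 := coeff_mul_of_vanish_left hv g'
  have h2 := coeff_mul_of_vanish_right h1.1 g
  refine ⟨g0, g0', fun n hn => ?_, ?_⟩
  · rw [← sub_eq_zero, ← map_sub, key, h2.1 n hn]
  · rw [← map_sub, key, h2.2, h1.2, g0, g0', mul_one, one_mul, map_neg, map_sub, h.top]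

lemma succ (h : Near M f g 0) : Near (M + 1) f g (coeff (M + 1) f - coeff (M + 1) g) := by
  refine ⟨h.left, h.right, fun n hn => ?_, rfl⟩
  rcases Nat.lt_succ_iff_lt_or_eq.1 hn with h1 | rfl
  · exact h.below n h1
  · exact sub_eq_zero.1 h.top

end Near

variable [Algebra ℂ 𝔸]

/-- The formal power series `exp (x X ^ m)`. -/
noncomputable def expPow (m : ℕ) (x : 𝔸) : 𝔸⟦X⟧ :=
  PowerSeries.mk fun n => if m ∣ n then (((n / m)! : ℂ)⁻¹) • x ^ (n / m) else 0

lemma coeff_expPow (m : ℕ) (x : 𝔸) (n : ℕ) :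
    coeff n (expPow m x) = if m ∣ n then (((n / m)! : ℂ)⁻¹) • x ^ (n / m) else 0 :=
  coeff_mk _ _

lemma coeff_zero_expPow (m : ℕ) (x : 𝔸) : coeff 0 (expPow m x) = 1 := by
  simp [coeff_expPow]

lemma coeff_expPow_mul {m : ℕ} (hm : 0 < m) (x : 𝔸) (k : ℕ) :
    coeff (m * k) (expPow m x) = ((k ! : ℂ)⁻¹) • x ^ k := by
  simp [coeff_expPow, Nat.mul_div_cancel_left k hm]

lemma coeff_expPow_of_not_dvd {m n : ℕ} (x : 𝔸) (h : ¬ m ∣ n) : coeff n (expPow m x) = 0 := by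
  simp [coeff_expPow, h]

lemma sum_antidiagonal_exp {x y : 𝔸} (h : Commute x y) (k : ℕ) :
    ∑ p ∈ antidiagonal k, (((p.1)! : ℂ)⁻¹ • x ^ p.1) * (((p.2)! : ℂ)⁻¹ • y ^ p.2) =
      ((k ! : ℂ)⁻¹) • (x + y) ^ k := by
  rw [h.add_pow', Finset.smul_sum]
  refine Finset.sum_congr rfl fun p hp => ?_
  rw [mem_antidiagonal] at hp
  rw [smul_mul_smul_comm, ← Nat.cast_smul_eq_nsmul ℂ, smul_smul]
  congr 1
  have h1 := Nat.choose_mul_factorial_mul_factorial (show p.1 ≤ k by omega)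
  rw [show k - p.1 = p.2 by omega] at h1
  have h2 : ((k.choose p.1 : ℂ)) * (p.1)! * (p.2)! = k ! := by exact_mod_cast h1
  have hk : (k ! : ℂ) ≠ 0 := by exact_mod_cast Nat.factorial_ne_zero k
  have h3 : ((p.1)! : ℂ) ≠ 0 := by exact_mod_cast Nat.factorial_ne_zero _
  have h4 : ((p.2)! : ℂ) ≠ 0 := by exact_mod_cast Nat.factorial_ne_zero _
  field_simp
  rw [← h2]; ring

lemma expPow_mul_expPow {m : ℕ} (hm : 0 < m) {x y : 𝔸} (h : Commute x y) :
    expPow m x * expPow m y = expPow m (x + y) := by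
  ext n
  rw [coeff_mul]
  by_cases hn : m ∣ n
  · obtain ⟨k, rfl⟩ := hn
    rw [coeff_expPow_mul hm, ← sum_antidiagonal_exp h]
    symm
    -- Only pairs of multiples of `m` contribute to the Cauchy product.
    apply Finset.sum_of_injOn (fun p => (m * p.1, m * p.2))
    · rintro ⟨a, b⟩ - ⟨a', b'⟩ - hab
      simp only [Prod.mk.injEq, Nat.mul_right_inj hm.ne'] at hab
      simp [hab]
    · rintro ⟨a, b⟩ hab
      simp only [Finset.mem_coe, mem_antidiagonal] at hab ⊢
      rw [← hab]; ring
    · rintro ⟨a, b⟩ hab hnot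
      rw [mem_antidiagonal] at hab
      by_cases ha : m ∣ a
      · have hb : m ∣ b := (Nat.dvd_add_right ha).1
          (by simp only at hab; rw [hab]; exact dvd_mul_right _ _)
        obtain ⟨a', rfl⟩ := ha
        obtain ⟨b', rfl⟩ := hb
        refine (hnot ⟨(a', b'), ?_, rfl⟩).elim
        simp only [Finset.mem_coe, mem_antidiagonal]
        simp only [← Nat.mul_add] at hab
        exact Nat.eq_of_mul_eq_mul_left hm hab
      · simp only [coeff_expPow_of_not_dvd x ha, zero_mul]
    · rintro ⟨a, b⟩ -
      simp only [coeff_expPow_mul hm]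
  · rw [coeff_expPow_of_not_dvd _ hn]
    refine Finset.sum_eq_zero ?_
    rintro ⟨a, b⟩ hab
    rw [mem_antidiagonal] at hab
    by_cases ha : m ∣ a
    · have hb : ¬ m ∣ b := fun hb => hn (hab ▸ dvd_add ha hb)
      simp only [coeff_expPow_of_not_dvd y hb, mul_zero]
    · simp only [coeff_expPow_of_not_dvd x ha, zero_mul]

lemma expPow_zero {m : ℕ} (hm : 0 < m) : expPow m (0 : 𝔸) = 1 := by
  ext n
  rw [coeff_one]
  split_ifs with h
  · subst h; exact coeff_zero_expPow m 0
  · by_cases hn : m ∣ n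
    · obtain ⟨k, rfl⟩ := hn
      rw [coeff_expPow_mul hm]
      have : k ≠ 0 := by rintro rfl; simp at h
      simp [this]
    · exact coeff_expPow_of_not_dvd _ hn

lemma expPow_mul_neg {m : ℕ} (hm : 0 < m) (x : 𝔸) : expPow m x * expPow m (-x) = 1 := by
  rw [expPow_mul_expPow hm (Commute.neg_right (Commute.refl x)), add_neg_cancel, expPow_zero hm]

/-- Replacing `X` by `a X` in a power series. -/
noncomputable def dil (a : ℂ) : 𝔸⟦X⟧ →+* 𝔸⟦X⟧ where
  toFun f := PowerSeries.mk fun n => a ^ n • coeff n f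
  map_one' := by
    ext n
    rw [coeff_mk, coeff_one]
    split_ifs with h <;> simp [h]
  map_mul' f g := by
    ext n
    rw [coeff_mk, coeff_mul, coeff_mul, Finset.smul_sum]
    refine Finset.sum_congr rfl fun p hp => ?_
    rw [mem_antidiagonal] at hp
    rw [coeff_mk, coeff_mk, smul_mul_smul_comm, ← pow_add, hp]
  map_zero' := by ext n; simp
  map_add' f g := by ext n; simp

lemma coeff_dil (a : ℂ) (f : 𝔸⟦X⟧) (n : ℕ) : coeff n (dil a f) = a ^ n • coeff n f := by
  change coeff n (PowerSeries.mk fun n => a ^ n • coeff n f) = _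
  rw [coeff_mk]

lemma dil_expPow {m : ℕ} (hm : 0 < m) (a : ℂ) (x : 𝔸) :
    dil a (expPow m x) = expPow m (a ^ m • x) := by
  ext n
  rw [coeff_dil]
  by_cases hn : m ∣ n
  · obtain ⟨k, rfl⟩ := hn
    rw [coeff_expPow_mul hm, coeff_expPow_mul hm, smul_pow, smul_comm, pow_mul]
  · rw [coeff_expPow_of_not_dvd _ hn, coeff_expPow_of_not_dvd _ hn, smul_zero]

lemma Near.dil {M : ℕ} {f g : 𝔸⟦X⟧} {d : 𝔸} (a : ℂ) (h : Near M f g d) :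
    Near M (dil a f) (dil a g) (a ^ M • d) := by
  refine ⟨by simp [coeff_dil, h.left], by simp [coeff_dil, h.right], fun n hn => ?_, ?_⟩
  · rw [coeff_dil, coeff_dil, h.below n hn]
  · rw [coeff_dil, coeff_dil, ← smul_sub, h.top]

/-- The power series of the word `w` in the exponentials of `y` and `z`. -/
noncomputable def wordSeries (y z : 𝔸) (w : ExpWord) : 𝔸⟦X⟧ :=
  w.run (fun a => expPow 1 ((a : ℂ) • y)) (fun a => expPow 1 ((a : ℂ) • z))

end Series

/-! ### Words of exponentials -/

section Words

variable {M : Type*} [Monoid M]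

lemma ExpWord.run_nil (U V : ℝ → M) : ExpWord.run [] U V = 1 := rfl

lemma ExpWord.run_cons (x : Gen × ℝ) (w : ExpWord) (U V : ℝ → M) :
    ExpWord.run (x :: w) U V =
      (match x.1 with
        | Gen.fst => U x.2
        | Gen.snd => V x.2) * ExpWord.run w U V := by
  obtain ⟨g, a⟩ := x
  cases g <;> simp [ExpWord.run]

lemma ExpWord.run_append (w w' : ExpWord) (U V : ℝ → M) :
    ExpWord.run (w ++ w') U V = w.run U V * w'.run U V := by
  simp [ExpWord.run]

/-- The word with all times multiplied by `a`. -/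
def ExpWord.scale (a : ℝ) (w : ExpWord) : ExpWord := w.map fun x => (x.1, a * x.2)

lemma ExpWord.scale_append (a : ℝ) (w w' : ExpWord) :
    ExpWord.scale a (w ++ w') = ExpWord.scale a w ++ ExpWord.scale a w' := List.map_append

lemma ExpWord.scale_inv (a : ℝ) (w : ExpWord) :
    ExpWord.scale a w.inv = ExpWord.inv (w.scale a) := by
  simp [ExpWord.scale, ExpWord.inv, Function.comp_def]

lemma ExpWord.run_scale (a : ℝ) (w : ExpWord) (U V : ℝ → M) :
    (w.scale a).run U V = w.run (fun s => U (a * s)) (fun s => V (a * s)) := by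
  simp [ExpWord.scale, ExpWord.run, Function.comp_def]

lemma ExpWord.run_inv_mul {U V : ℝ → M} (hU : ∀ a, U (-a) * U a = 1)
    (hV : ∀ a, V (-a) * V a = 1) (w : ExpWord) : w.inv.run U V * w.run U V = 1 := by
  induction w with
  | nil => simp [ExpWord.inv, ExpWord.run]
  | cons x w ih =>
    have h : ExpWord.inv (x :: w) = ExpWord.inv w ++ [(x.1, -x.2)] := by
      simp [ExpWord.inv]
    rw [h, ExpWord.run_append, ExpWord.run_cons, ExpWord.run_cons, ExpWord.run_nil, mul_one]
    obtain ⟨g, a⟩ := x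
    cases g
    · simp only [mul_assoc]
      rw [← mul_assoc (U (-a)), hU, one_mul, ih]
    · simp only [mul_assoc]
      rw [← mul_assoc (V (-a)), hV, one_mul, ih]

lemma ExpWord.map_run {N F : Type*} [Monoid N] [FunLike F M N] [MonoidHomClass F M N] (ψ : F)
    (w : ExpWord) (U V : ℝ → M) :
    ψ (w.run U V) = w.run (fun a => ψ (U a)) (fun a => ψ (V a)) := by
  induction w with
  | nil => simp [ExpWord.run]
  | cons x w ih =>
    rw [ExpWord.run_cons, ExpWord.run_cons, map_mul, ih]
    obtain ⟨g, a⟩ := x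
    cases g <;> rfl

/-- Every time in the word is proportional to `t`, so the word at time `1` carries all the
information and the series variable plays the role of time. -/
lemma bchWord_scale (p : ℕ) (a t : ℝ) : bchWord p (a * t) = (bchWord p t).scale a := by
  induction p generalizing t with
  | zero => rfl
  | succ p ih =>
    cases p with
    | zero => simp [bchWord, ExpWord.scale]
    | succ p =>
      simp only [bchWord, ExpWord.scale_append, ExpWord.scale_inv, ← ih]
      simp only [mul_left_comm, mul_neg]

lemma length_bchWord (p : ℕ) (t : ℝ) : (bchWord (p + 1) t).length = 4 * 6 ^ p := by
  induction p generalizing t with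
  | zero => rfl
  | succ p ih =>
    simp only [bchWord, List.length_append, ExpWord.inv, List.length_map, List.length_reverse, ih]
    ring

end Words

/-! ### The coefficients of the recursion -/

lemma rpow_two_lt_two {p : ℕ} (hp : 1 ≤ p) : (2 : ℝ) ^ (2 / (2 * (p : ℝ) + 2)) < 2 := by
  have hp' : (1 : ℝ) ≤ p := by exact_mod_cast hp
  conv_rhs => rw [← Real.rpow_one 2]
  apply Real.rpow_lt_rpow_of_exponent_lt (by norm_num)
  rw [div_lt_one (by positivity)]
  linarith

lemma bchR_pos {p : ℕ} (hp : 1 ≤ p) : 0 < bchR p := by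
  have := rpow_two_lt_two hp
  unfold bchR
  apply div_pos (by positivity)
  linarith

lemma bchBeta_pos {p : ℕ} (hp : 1 ≤ p) : 0 < bchBeta p :=
  Real.sqrt_pos.2 (by have := bchR_pos hp; positivity)

lemma bchGamma_pos {p : ℕ} (hp : 1 ≤ p) : 0 < bchGamma p :=
  Real.sqrt_pos.2 (by have := bchR_pos hp; positivity)

lemma bchBeta_sq {p : ℕ} (hp : 1 ≤ p) : bchBeta p ^ 2 = 2 * bchR p :=
  Real.sq_sqrt (by have := bchR_pos hp; positivity)

lemma bchGamma_sq {p : ℕ} (hp : 1 ≤ p) : bchGamma p ^ 2 = 1 / 4 + bchR p :=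
  Real.sq_sqrt (by have := bchR_pos hp; positivity)

/-- The equation that fixes `r_p`: the leading errors cancel. -/
lemma two_mul_bchGamma_pow {p : ℕ} (hp : 1 ≤ p) :
    2 * bchGamma p ^ (2 * p + 2) = bchBeta p ^ (2 * p + 2) := by
  have h1 : 2 * p + 2 = 2 * (p + 1) := by ring
  rw [h1, pow_mul, pow_mul, bchBeta_sq hp, bchGamma_sq hp]
  set b : ℝ := (2 : ℝ) ^ (2 / (2 * (p : ℝ) + 2)) with hb
  have hb2 : b < 2 := rpow_two_lt_two hp
  have hbp : b ^ (p + 1) = 2 := by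
    rw [hb, ← Real.rpow_natCast, ← Real.rpow_mul (by norm_num)]
    have : (2 / (2 * (p : ℝ) + 2)) * ((p + 1 : ℕ) : ℝ) = 1 := by
      push_cast; field_simp
    rw [this, Real.rpow_one]
  -- This says `β² = b γ²`; raising it to the power `p + 1` and using `b ^ (p + 1) = 2` gives the
  -- claim.
  have key : 2 * bchR p = b * (1 / 4 + bchR p) := by
    unfold bchR
    rw [← hb]
    have : (2 - b) ≠ 0 := by linarith
    field_simp
    ring
  rw [key, mul_pow, hbp]

/-! ### Order of the commutator formula -/

section Order

variable {𝔸 : Type*} [Ring 𝔸] [Algebra ℂ 𝔸]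

lemma dil_dil (a b : ℂ) (f : 𝔸⟦X⟧) : dil a (dil b f) = dil (a * b) f := by
  ext n
  simp only [coeff_dil, smul_smul, mul_pow]

lemma wordSeries_append (y z : 𝔸) (w w' : ExpWord) :
    wordSeries y z (w ++ w') = wordSeries y z w * wordSeries y z w' :=
  ExpWord.run_append w w' _ _

lemma wordSeries_scale (y z : 𝔸) (a : ℝ) (w : ExpWord) :
    wordSeries y z (w.scale a) = dil a (wordSeries y z w) := by
  unfold wordSeries
  rw [ExpWord.map_run, ExpWord.run_scale]
  simp only [dil_expPow one_pos, pow_one, smul_smul, Complex.ofReal_mul]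

lemma wordSeries_inv_mul (y z : 𝔸) (w : ExpWord) :
    wordSeries y z w.inv * wordSeries y z w = 1 := by
  have h : ∀ (x : 𝔸) (a : ℝ), expPow 1 (((-a : ℝ) : ℂ) • x) * expPow 1 ((a : ℂ) • x) = 1 := by
    intro x a
    have := expPow_mul_neg one_pos (-((a : ℂ) • x))
    rwa [neg_neg, ← neg_smul, ← Complex.ofReal_neg] at this
  exact ExpWord.run_inv_mul (h y) (h z) w

lemma wordSeries_bchWord (y z : 𝔸) (p : ℕ) (a : ℝ) :
    wordSeries y z (bchWord p a) = dil a (wordSeries y z (bchWord p 1)) := by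
  rw [← wordSeries_scale, ← bchWord_scale, mul_one]

lemma near_bchWord_one (y z : 𝔸) :
    Near 3 (wordSeries y z (bchWord 1 1)) (expPow 2 (y * z - z * y))
      (coeff 3 (wordSeries y z (bchWord 1 1)) - coeff 3 (expPow 2 (y * z - z * y))) := by
  have hw : wordSeries y z (bchWord 1 1) =
      expPow 1 y * expPow 1 z * expPow 1 (-y) * expPow 1 (-z) := by
    simp [wordSeries, bchWord, ExpWord.run, mul_assoc]
  have c0 : ∀ x : 𝔸, coeff 0 (expPow 1 x) = 1 := fun x => coeff_zero_expPow 1 x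
  have c1 : ∀ x : 𝔸, coeff 1 (expPow 1 x) = x := fun x => by simp [coeff_expPow]
  have c2 : ∀ x : 𝔸, coeff 2 (expPow 1 x) = (2 : ℂ)⁻¹ • (x * x) := fun x => by
    simp [coeff_expPow, pow_two]
  have m0 : ∀ f g : 𝔸⟦X⟧, coeff 0 (f * g) = coeff 0 f * coeff 0 g := fun f g => by
    simp [coeff_mul]
  have m1 : ∀ f g : 𝔸⟦X⟧, coeff 1 (f * g) = coeff 0 f * coeff 1 g + coeff 1 f * coeff 0 g :=
    fun f g => by
      rw [coeff_mul, Finset.Nat.antidiagonal_succ]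
      simp
  have m2 : ∀ f g : 𝔸⟦X⟧, coeff 2 (f * g) =
      coeff 0 f * coeff 2 g + (coeff 1 f * coeff 1 g + coeff 2 f * coeff 0 g) := fun f g => by
    rw [coeff_mul, Finset.Nat.antidiagonal_succ, Finset.sum_cons, Finset.sum_map,
      Finset.Nat.antidiagonal_succ, Finset.sum_cons, Finset.sum_map]
    simp
  have e1 : coeff 1 (expPow 2 (y * z - z * y)) = 0 := by simp [coeff_expPow]
  have e2 : coeff 2 (expPow 2 (y * z - z * y)) = y * z - z * y := by simp [coeff_expPow]
  refine ⟨?_, coeff_zero_expPow _ _, fun n hn => ?_, rfl⟩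
  · rw [hw]; simp only [m0, c0, mul_one]
  · interval_cases n
    · rw [hw, coeff_zero_expPow]; simp only [m0, c0, mul_one]
    · rw [hw, e1]; simp only [m1, m0, c0, c1, mul_one, one_mul]; abel
    · rw [hw, e2]
      simp only [m2, m1, m0, c0, c1, c2, mul_one, one_mul, neg_mul, mul_neg, neg_neg,
        add_mul]
      module

/-- One recursion step gains two degrees: one from symmetrization `X ↦ -X`, one from the choice of
`r_p`. -/
lemma near_bchWord_succ (y z c : 𝔸) {p M : ℕ} (hp : 1 ≤ p) (hM : M = 2 * p + 1) {d : 𝔸}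
    (h : Near M (wordSeries y z (bchWord p 1)) (expPow 2 c) d) :
    ∃ e, Near (M + 2) (wordSeries y z (bchWord (p + 1) 1)) (expPow 2 c) e := by
  obtain ⟨p, rfl⟩ : ∃ k, p = k + 1 := ⟨p - 1, by omega⟩
  have hpos : 0 < 2 := two_pos
  set W := wordSeries y z (bchWord (p + 1) 1) with hW
  have hw : ∀ a : ℝ, wordSeries y z (bchWord (p + 1) a) = dil a W :=
    wordSeries_bchWord y z (p + 1)
  -- `M` is odd, so the leading errors of `W(X)` and `W(-X)` cancel, while the exponents `c X²` add
  -- up to `2c X²`.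
  have hf0 := h.mul (h.dil (-1))
  rw [show d + (-1 : ℂ) ^ M • d = 0 by
    rw [hM, pow_succ, pow_mul]; simp, dil_expPow hpos,
    expPow_mul_expPow hpos ((Commute.refl c).smul_right _)] at hf0
  have hf := hf0.succ
  set f := W * dil (-1) W with hfdef
  generalize coeff (M + 1) f - coeff (M + 1) _ = e at hf
  have hE : Even (M + 1) := ⟨p + 2, by omega⟩
  set γ := bchGamma (p + 1) with hγ
  set β := bchBeta (p + 1) with hβ
  set x : 𝔸 := c + (-1 : ℂ) ^ 2 • c with hx
  have hfγ := hf.dil (γ : ℂ)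
  have hfβ := hf.dil (-β : ℂ)
  rw [dil_expPow hpos] at hfγ hfβ
  have eγ : dil (γ : ℂ) f = dil (γ : ℂ) W * dil ((-γ : ℝ) : ℂ) W := by
    rw [hfdef, map_mul, dil_dil]; simp
  have eβ : dil (-β : ℂ) f = dil ((-β : ℝ) : ℂ) W * dil (β : ℂ) W := by
    rw [hfdef, map_mul, dil_dil]; simp
  -- The two middle factors together invert `f(-βX)`, in which the factor at `-β` comes first.
  have hinv : wordSeries y z (bchWord (p + 1) β).inv * wordSeries y z (bchWord (p + 1) (-β)).inv *
      dil (-β : ℂ) f = 1 := by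
    rw [eβ, ← hw, ← hw, mul_assoc, ← mul_assoc (wordSeries y z (bchWord (p + 1) (-β)).inv),
      wordSeries_inv_mul, one_mul, wordSeries_inv_mul]
  have hg := hfβ.inv hinv (expPow_mul_neg hpos _)
  have htot := (hfγ.mul hg).mul hfγ
  have hcom : ∀ a b : ℂ, Commute (a • x) (b • x) := fun a b =>
    ((Commute.refl x).smul_left a).smul_right b
  rw [← neg_smul, expPow_mul_expPow hpos (hcom _ _), ← add_smul,
    expPow_mul_expPow hpos (hcom _ _), ← add_smul] at htot
  -- With `x = 2c`, normalization is `2γ² - β² = 1/2`, whatever the value of `r`.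
  have hsq : ((γ : ℂ) ^ 2 + -(-β : ℂ) ^ 2 + (γ : ℂ) ^ 2) • x = c := by
    have h1 : (γ : ℂ) ^ 2 = 1 / 4 + (bchR (p + 1) : ℂ) := by
      have := bchGamma_sq hp
      rw [hγ, ← Complex.ofReal_pow, this]; push_cast; ring
    have h2 : (β : ℂ) ^ 2 = 2 * (bchR (p + 1) : ℂ) := by
      have := bchBeta_sq hp
      rw [hβ, ← Complex.ofReal_pow, this]; push_cast; ring
    rw [neg_sq, h1, h2, hx]
    module
  -- Here the value of `r` matters: `2γ^(2p+2) = β^(2p+2)` for the order `p` being raised.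
  have hzero : (γ : ℂ) ^ (M + 1) • e + -((-β : ℂ) ^ (M + 1) • e) + (γ : ℂ) ^ (M + 1) • e = 0 := by
    have h1 : 2 * (γ : ℂ) ^ (M + 1) = (β : ℂ) ^ (M + 1) := by
      have := two_mul_bchGamma_pow hp
      rw [← hγ, ← hβ, show 2 * (p + 1) + 2 = M + 1 by omega] at this
      exact_mod_cast this
    rw [hE.neg_pow, ← h1]
    module
  rw [hsq, hzero] at htot
  have hword : wordSeries y z (bchWord (p + 1 + 1) 1) = dil (γ : ℂ) f *
      (wordSeries y z (bchWord (p + 1) β).inv * wordSeries y z (bchWord (p + 1) (-β)).inv) *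
      dil (γ : ℂ) f := by
    simp only [bchWord, mul_one, wordSeries_append, hw, eγ, mul_assoc, ← hγ, ← hβ]
  rw [hword]
  exact ⟨_, htot.succ⟩

/-- `BCH_p` agrees with `exp (s² [y, z])` through order `2 p`. -/
lemma coeff_bchWord (y z : 𝔸) {p : ℕ} (hp : 1 ≤ p) {n : ℕ} (hn : n < 2 * p + 1) :
    coeff n (wordSeries y z (bchWord p 1)) = coeff n (expPow 2 (y * z - z * y)) := by
  suffices h : ∃ d, Near (2 * p + 1) (wordSeries y z (bchWord p 1)) (expPow 2 (y * z - z * y)) d by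
    obtain ⟨d, hd⟩ := h
    exact hd.below n hn
  clear hn
  induction p, hp using Nat.le_induction with
  | base => exact ⟨_, near_bchWord_one y z⟩
  | succ p hp ih =>
    obtain ⟨d, hd⟩ := ih
    exact near_bchWord_succ y z _ hp rfl hd

end Order

/-! ### From formal series to norm estimates -/

section Analytic

variable {𝔸 : Type*} [NormedRing 𝔸]

/-- The coefficients of `f` are bounded by those of `exp (L X)`. -/
def ExpBounded (f : 𝔸⟦X⟧) (L : ℝ) : Prop := ∀ n, ‖coeff n f‖ ≤ L ^ n / n !

lemma ExpBounded.mul {f g : 𝔸⟦X⟧} {L L' : ℝ} (hL : 0 ≤ L) (hf : ExpBounded f L)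
    (hg : ExpBounded g L') : ExpBounded (f * g) (L + L') := fun n => by
  rw [coeff_mul]
  refine (norm_sum_le _ _).trans ?_
  have h1 : ∀ p ∈ antidiagonal n, ‖coeff p.1 f * coeff p.2 g‖ ≤
      (L ^ p.1 / (p.1)!) * (L' ^ p.2 / (p.2)!) := fun p _ =>
    (norm_mul_le _ _).trans
      (mul_le_mul (hf _) (hg _) (norm_nonneg _) (by positivity))
  refine (Finset.sum_le_sum h1).trans (le_of_eq ?_)
  rw [(Commute.all L L').add_pow', Finset.sum_div]
  refine Finset.sum_congr rfl fun p hp => ?_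
  rw [mem_antidiagonal] at hp
  have h2 := Nat.choose_mul_factorial_mul_factorial (show p.1 ≤ n by omega)
  rw [show n - p.1 = p.2 by omega] at h2
  have h3 : ((n.choose p.1 : ℝ)) * (p.1)! * (p.2)! = n ! := by exact_mod_cast h2
  rw [nsmul_eq_mul, ← h3]
  have : (n.choose p.1 : ℝ) ≠ 0 := by
    exact_mod_cast (Nat.choose_pos (show p.1 ≤ n by omega)).ne'
  field_simp

/-- Assuming only `‖1‖ ≤ 1` keeps the zero Hilbert space, where `‖1‖ = 0`, within reach. -/
lemma norm_pow_le_of_norm_one_le (h1 : ‖(1 : 𝔸)‖ ≤ 1) {x : 𝔸} {C : ℝ} (hx : ‖x‖ ≤ C) (n : ℕ) :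
    ‖x ^ n‖ ≤ C ^ n := by
  rcases Nat.eq_zero_or_pos n with rfl | hn
  · simpa using h1
  · exact (norm_pow_le' x hn).trans (pow_le_pow_left₀ (norm_nonneg _) hx n)

variable [NormedAlgebra ℂ 𝔸]

lemma expBounded_expPow (h1 : ‖(1 : 𝔸)‖ ≤ 1) {x : 𝔸} {C : ℝ} (hx : ‖x‖ ≤ C) :
    ExpBounded (expPow 1 x) C := fun n => by
  rw [coeff_expPow, if_pos (one_dvd n), Nat.div_one, norm_smul, norm_inv, Complex.norm_natCast,
    div_eq_inv_mul]
  exact mul_le_mul_of_nonneg_left (norm_pow_le_of_norm_one_le h1 hx n) (by positivity)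

/-- The sum of the absolute values of the times of a word. -/
def ExpWord.duration (w : ExpWord) : ℝ := (w.map fun x => |x.2|).sum

lemma ExpWord.duration_nonneg (w : ExpWord) : 0 ≤ w.duration :=
  List.sum_nonneg (by simp only [List.mem_map]; rintro _ ⟨x, -, rfl⟩; exact abs_nonneg _)

lemma ExpWord.abs_le_duration {w : ExpWord} {x : Gen × ℝ} (hx : x ∈ w) : |x.2| ≤ w.duration :=
  List.single_le_sum (by simp only [List.mem_map]; rintro _ ⟨x, -, rfl⟩; exact abs_nonneg _) _
    (List.mem_map_of_mem (f := fun x : Gen × ℝ => |x.2|) hx)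

lemma expBounded_wordSeries (h1 : ‖(1 : 𝔸)‖ ≤ 1) {y z : 𝔸} {C : ℝ} (hy : ‖y‖ ≤ C) (hz : ‖z‖ ≤ C)
    (w : ExpWord) : ExpBounded (wordSeries y z w) (w.duration * C) := by
  have hC : 0 ≤ C := (norm_nonneg y).trans hy
  induction w with
  | nil =>
    intro n
    rw [wordSeries, ExpWord.run_nil, coeff_one]
    split_ifs with h
    · subst h; simpa using h1
    · simp [ExpWord.duration, h]
  | cons x w ih =>
    have hd : ExpWord.duration (x :: w) * C = |x.2| * C + ExpWord.duration w * C := by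
      simp [ExpWord.duration, add_mul]
    rw [hd, wordSeries, ExpWord.run_cons]
    refine ExpBounded.mul (by positivity) ?_ ih
    have key : ∀ v : 𝔸, ‖v‖ ≤ C → ‖(x.2 : ℂ) • v‖ ≤ |x.2| * C := fun v hv => by
      rw [norm_smul, Complex.norm_real, Real.norm_eq_abs]
      exact mul_le_mul_of_nonneg_left hv (abs_nonneg _)
    obtain ⟨g, a⟩ := x
    cases g
    · exact expBounded_expPow h1 (key y hy)
    · exact expBounded_expPow h1 (key z hz)

lemma norm_coeff_expPow_two_le (h1 : ‖(1 : 𝔸)‖ ≤ 1) {c : 𝔸} {R : ℝ} (hR : 0 ≤ R)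
    (hc : ‖c‖ ≤ R ^ 2) (n : ℕ) : ‖coeff n (expPow 2 c)‖ ≤ R ^ n := by
  by_cases hn : 2 ∣ n
  · obtain ⟨k, rfl⟩ := hn
    rw [coeff_expPow_mul two_pos, norm_smul, norm_inv, Complex.norm_natCast, pow_mul]
    have h2 : ((k ! : ℝ))⁻¹ ≤ 1 := inv_le_one_of_one_le₀ (by exact_mod_cast k.factorial_pos)
    calc _ ≤ 1 * (R ^ 2) ^ k := mul_le_mul h2 (norm_pow_le_of_norm_one_le h1 hc k)
          (norm_nonneg _) zero_le_one
      _ = _ := one_mul _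
  · rw [coeff_expPow_of_not_dvd _ hn, norm_zero]
    positivity

/-- The power series `f` converges absolutely at `s`, with sum `v`. -/
structure EvalsTo (f : 𝔸⟦X⟧) (s : ℂ) (v : 𝔸) : Prop where
  summable : Summable fun n => ‖s ^ n • coeff n f‖
  hasSum : HasSum (fun n => s ^ n • coeff n f) v

/-- Geometric tail: a ratio of at most `1/2` doubles the first term `2 (R s)^N`. -/
lemma norm_le_of_vanishing_coeff {f : 𝔸⟦X⟧} {s R : ℝ} {v : 𝔸} {N : ℕ} (hs : 0 ≤ s) (hR : 0 ≤ R)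
    (h : HasSum (fun n => (s : ℂ) ^ n • coeff n f) v) (h0 : ∀ n < N, coeff n f = 0)
    (hb : ∀ n, ‖coeff n f‖ ≤ 2 * R ^ n) (hsR : R * s ≤ 1 / 2) : ‖v‖ ≤ 4 * (R * s) ^ N := by
  have hr : 0 ≤ R * s := mul_nonneg hR hs
  have hshift : HasSum (fun n => (s : ℂ) ^ (n + N) • coeff (n + N) f) v := by
    have := (hasSum_nat_add_iff' (f := fun n => (s : ℂ) ^ n • coeff n f) N).2 h
    rwa [Finset.sum_eq_zero, sub_zero] at this
    intro i hi
    rw [h0 i (Finset.mem_range.1 hi), smul_zero]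
  have hg := (hasSum_geometric_of_lt_one hr (by linarith)).mul_left (2 * (R * s) ^ N)
  refine (hshift.norm_le_of_bounded hg fun n => ?_).trans ?_
  · rw [norm_smul, norm_pow, Complex.norm_real, Real.norm_of_nonneg hs]
    calc s ^ (n + N) * ‖coeff (n + N) f‖ ≤ s ^ (n + N) * (2 * R ^ (n + N)) :=
          mul_le_mul_of_nonneg_left (hb _) (by positivity)
      _ = _ := by rw [pow_add, pow_add]; ring
  · have : (1 - R * s)⁻¹ ≤ 2 := by
      rw [inv_le_comm₀ (by linarith) (by norm_num)]
      linarith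
    calc 2 * (R * s) ^ N * (1 - R * s)⁻¹ ≤ 2 * (R * s) ^ N * 2 :=
          mul_le_mul_of_nonneg_left this (by positivity)
      _ = _ := by ring

variable [CompleteSpace 𝔸]

lemma EvalsTo.mul {f g : 𝔸⟦X⟧} {s : ℂ} {v u : 𝔸} (hf : EvalsTo f s v) (hg : EvalsTo g s u) :
    EvalsTo (f * g) s (v * u) := by
  have h : ∀ n, s ^ n • coeff n (f * g) =
      ∑ p ∈ antidiagonal n, (s ^ p.1 • coeff p.1 f) * (s ^ p.2 • coeff p.2 g) := fun n => by
    rw [coeff_mul, Finset.smul_sum]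
    refine Finset.sum_congr rfl fun p hp => ?_
    rw [mem_antidiagonal] at hp
    rw [smul_mul_smul_comm, ← pow_add, hp]
  have hs := summable_norm_sum_mul_antidiagonal_of_summable_norm hf.summable hg.summable
  refine ⟨by simpa only [h] using hs, ?_⟩
  simp only [h]
  rw [← hf.hasSum.tsum_eq, ← hg.hasSum.tsum_eq,
    tsum_mul_tsum_eq_tsum_sum_antidiagonal_of_summable_norm hf.summable hg.summable]
  exact hs.of_norm.hasSum

lemma evalsTo_expPow {m : ℕ} (hm : 0 < m) (x : 𝔸) (s : ℂ) :
    EvalsTo (expPow m x) s (NormedSpace.exp (s ^ m • x)) := by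
  have hinj : Function.Injective (fun k : ℕ => m * k) := fun a b h => Nat.eq_of_mul_eq_mul_left hm h
  have h0 : ∀ n, n ∉ Set.range (fun k : ℕ => m * k) → s ^ n • coeff n (expPow m x) = 0 := by
    intro n hn
    rw [coeff_expPow_of_not_dvd x (fun ⟨k, hk⟩ => hn ⟨k, hk.symm⟩), smul_zero]
  have he : ((fun n => s ^ n • coeff n (expPow m x)) ∘ fun k : ℕ => m * k) =
      fun k => ((k ! : ℂ)⁻¹) • (s ^ m • x) ^ k := by
    ext k
    rw [Function.comp_apply, coeff_expPow_mul hm, smul_pow, smul_comm, pow_mul]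
  constructor
  · rw [← hinj.summable_iff]
    · have := NormedSpace.norm_expSeries_summable' (𝕂 := ℂ) (s ^ m • x)
      exact this.congr fun k => congrArg norm (congrFun he k).symm
    · intro n hn
      rw [h0 n hn, norm_zero]
  · rw [← hinj.hasSum_iff h0, he]
    exact NormedSpace.exp_series_hasSum_exp' (𝕂 := ℂ) _

lemma evalsTo_wordSeries (y z : 𝔸) (s : ℝ) (w : ExpWord) :
    EvalsTo (wordSeries y z w) s ((w.scale s).run (fun a => NormedSpace.exp ((a : ℂ) • y))
      (fun a => NormedSpace.exp ((a : ℂ) • z))) := by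
  rw [ExpWord.run_scale]
  have key : ∀ (v : 𝔸) (a : ℝ), EvalsTo (expPow 1 ((a : ℂ) • v)) s
      (NormedSpace.exp (((s * a : ℝ) : ℂ) • v)) := fun v a => by
    have := evalsTo_expPow one_pos ((a : ℂ) • v) s
    rwa [pow_one, smul_smul, ← Complex.ofReal_mul] at this
  induction w with
  | nil =>
    rw [wordSeries, ExpWord.run_nil, ExpWord.run_nil]
    have := evalsTo_expPow one_pos (0 : 𝔸) s
    rwa [expPow_zero one_pos, smul_zero, NormedSpace.exp_zero] at this
  | cons x w ih =>
    rw [wordSeries, ExpWord.run_cons, ExpWord.run_cons]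
    refine EvalsTo.mul ?_ ih
    obtain ⟨g, a⟩ := x
    cases g
    · exact key y a
    · exact key z a

/-- The error of the commutator product formula `BCH_p`, uniformly over all generators. -/
theorem norm_bchWord_sub_exp_le (h1 : ‖(1 : 𝔸)‖ ≤ 1) {y z : 𝔸} {C : ℝ} (hy : ‖y‖ ≤ C)
    (hz : ‖z‖ ≤ C) {p : ℕ} (hp : 1 ≤ p) {L s : ℝ} (hL : (bchWord p 1).duration ≤ L) (hL2 : 2 ≤ L)
    (hs : 0 ≤ s) (hsL : L * C * s ≤ 1 / 2) :
    ‖(bchWord p s).run (fun a => NormedSpace.exp ((a : ℂ) • y))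
        (fun a => NormedSpace.exp ((a : ℂ) • z)) -
      NormedSpace.exp ((s : ℂ) ^ 2 • (y * z - z * y))‖ ≤ 4 * (L * C * s) ^ (2 * p + 1) := by
  have hC : 0 ≤ C := (norm_nonneg y).trans hy
  have hLC : 0 ≤ L * C := by positivity
  have hw := (evalsTo_wordSeries y z s (bchWord p 1)).hasSum
  rw [← bchWord_scale, mul_one] at hw
  have he := (evalsTo_expPow two_pos (y * z - z * y) s).hasSum
  -- The assumption `2 ≤ L` lets the single radius `L C` serve both series.
  have hc : ‖y * z - z * y‖ ≤ (L * C) ^ 2 := by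
    calc ‖y * z - z * y‖ ≤ ‖y‖ * ‖z‖ + ‖z‖ * ‖y‖ :=
          (norm_sub_le _ _).trans (add_le_add (norm_mul_le _ _) (norm_mul_le _ _))
      _ ≤ C * C + C * C := by gcongr
      _ ≤ (2 * C) ^ 2 := by nlinarith [mul_nonneg hC hC]
      _ ≤ (L * C) ^ 2 := by gcongr
  have hdiff := hw.sub he
  simp only [← smul_sub, ← map_sub] at hdiff
  refine norm_le_of_vanishing_coeff hs hLC hdiff (fun n hn => ?_) (fun n => ?_) hsL
  · rw [map_sub, coeff_bchWord y z hp hn, sub_self]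
  · rw [map_sub]
    refine (norm_sub_le _ _).trans ?_
    have h2 := norm_coeff_expPow_two_le h1 hLC hc n
    have h3 : ‖coeff n (wordSeries y z (bchWord p 1))‖ ≤ (L * C) ^ n := by
      refine (expBounded_wordSeries h1 hy hz _ n).trans ?_
      have hd := (bchWord p 1).duration_nonneg
      have hfac : (1 : ℝ) ≤ n ! := by exact_mod_cast n.factorial_pos
      refine (div_le_self (by positivity) hfac).trans ?_
      gcongr
    linarith

end Analytic

/-! ### Stability under inexact factors -/

section Perturbation

variable {𝔸 : Type*} [NormedRing 𝔸]

/-- Inexact factors have norm at most `2`, so the error obeys `e_{n+1} ≤ 2 e_n + ε`. -/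
lemma ExpWord.norm_run_sub_run_le (h1 : ‖(1 : 𝔸)‖ ≤ 1) {U V U' V' : ℝ → 𝔸} {ε : ℝ} (hε : 0 ≤ ε)
    (hε1 : ε ≤ 1) (hU : ∀ a, ‖U a‖ ≤ 1) (hV : ∀ a, ‖V a‖ ≤ 1) (w : ExpWord)
    (hUU : ∀ x ∈ w, ‖U' x.2 - U x.2‖ ≤ ε) (hVV : ∀ x ∈ w, ‖V' x.2 - V x.2‖ ≤ ε) :
    ‖w.run U' V' - w.run U V‖ ≤ (2 ^ w.length - 1) * ε ∧ ‖w.run U V‖ ≤ 1 := by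
  induction w with
  | nil => simpa [ExpWord.run] using h1
  | cons x w ih =>
    obtain ⟨ih1, ih2⟩ := ih (fun y hy => hUU y (List.mem_cons_of_mem _ hy))
      (fun y hy => hVV y (List.mem_cons_of_mem _ hy))
    have key : ∀ u u' : 𝔸, ‖u‖ ≤ 1 → ‖u' - u‖ ≤ ε →
        ‖u' * ExpWord.run w U' V' - u * ExpWord.run w U V‖ ≤ (2 ^ (w.length + 1) - 1) * ε ∧
          ‖u * ExpWord.run w U V‖ ≤ 1 := fun u u' hu hd => by
      have hu' : ‖u'‖ ≤ 2 := by
        calc ‖u'‖ = ‖(u' - u) + u‖ := by rw [sub_add_cancel]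
          _ ≤ ‖u' - u‖ + ‖u‖ := norm_add_le _ _
          _ ≤ 2 := by linarith
      constructor
      · calc ‖u' * ExpWord.run w U' V' - u * ExpWord.run w U V‖
            = ‖u' * (ExpWord.run w U' V' - ExpWord.run w U V) +
                (u' - u) * ExpWord.run w U V‖ := by congr 1; noncomm_ring
          _ ≤ ‖u'‖ * ‖ExpWord.run w U' V' - ExpWord.run w U V‖ +
                ‖u' - u‖ * ‖ExpWord.run w U V‖ :=
              (norm_add_le _ _).trans (add_le_add (norm_mul_le _ _) (norm_mul_le _ _))
          _ ≤ 2 * ((2 ^ w.length - 1) * ε) + ε * 1 := by gcongr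
          _ = _ := by ring
      · calc ‖u * ExpWord.run w U V‖ ≤ ‖u‖ * ‖ExpWord.run w U V‖ := norm_mul_le _ _
          _ ≤ 1 * 1 := by gcongr
          _ = 1 := one_mul 1
    rw [ExpWord.run_cons, ExpWord.run_cons, List.length_cons]
    have hx := hUU x List.mem_cons_self
    have hx' := hVV x List.mem_cons_self
    obtain ⟨g, a⟩ := x
    cases g
    · exact key _ _ (hU a) hx
    · exact key _ _ (hV a) hx'

/-- From `v - b' = v (b - u) b'`, the distance `D = ‖v - b'‖` satisfies `D ≤ (D + 1) ε/2`, hence `D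
≤ ε` for `ε ≤ 1`. -/
lemma norm_inv_sub_inv_le {u v b b' : 𝔸} {ε : ℝ} (hε1 : ε ≤ 1) (hvu : v * u = 1)
    (hb : b * b' = 1) (hb' : ‖b'‖ ≤ 1) (h : ‖u - b‖ ≤ ε / 2) : ‖v - b'‖ ≤ ε := by
  have hε : 0 ≤ ε := by linarith [norm_nonneg (u - b)]
  have h1 : v - b' = v * (b - u) * b' := by
    have : v * (b - u) * b' = v * (b * b') - (v * u) * b' := by noncomm_ring
    rw [this, hb, hvu, mul_one, one_mul]
  have h2 : ‖v‖ ≤ ‖v - b'‖ + 1 := by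
    calc ‖v‖ = ‖(v - b') + b'‖ := by rw [sub_add_cancel]
      _ ≤ ‖v - b'‖ + ‖b'‖ := norm_add_le _ _
      _ ≤ _ := by linarith
  have h3 : ‖v - b'‖ ≤ (‖v - b'‖ + 1) * (ε / 2) * 1 := by
    calc ‖v - b'‖ = ‖v * (b - u) * b'‖ := congrArg norm h1
      _ ≤ ‖v‖ * ‖b - u‖ * ‖b'‖ :=
          (norm_mul_le _ _).trans (mul_le_mul_of_nonneg_right (norm_mul_le _ _) (norm_nonneg _))
      _ ≤ (‖v - b'‖ + 1) * (ε / 2) * 1 := by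
          rw [norm_sub_rev] at h
          gcongr
  nlinarith [norm_nonneg (v - b')]

lemma exp_smul_mul_exp_neg_smul [NormedAlgebra ℂ 𝔸] [CompleteSpace 𝔸] (a : ℂ) (x : 𝔸) :
    NormedSpace.exp (a • x) * NormedSpace.exp (-a • x) = 1 := by
  let _ : NormedAlgebra ℚ 𝔸 := NormedAlgebra.restrictScalars ℚ ℂ 𝔸
  rw [neg_smul, ← NormedSpace.exp_add_of_commute (Commute.neg_right (Commute.refl _)),
    add_neg_cancel, NormedSpace.exp_zero]

end Perturbation

/-! ### Block operators, qubit gates and generators -/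

section Blocks

variable {H : Type*} [NormedAddCommGroup H] [InnerProductSpace ℂ H]

lemma blockOp_apply (P Q R T : H →L[ℂ] H) (v : QubitMode H) :
    blockOp P Q R T v = WithLp.toLp 2 (P v.fst + Q v.snd, R v.fst + T v.snd) := rfl

lemma blockOp_mul (P Q R T P' Q' R' T' : H →L[ℂ] H) :
    blockOp P Q R T * blockOp P' Q' R' T' =
      blockOp (P * P' + Q * R') (P * Q' + Q * T') (R * P' + T * R') (R * Q' + T * T') := by
  refine ContinuousLinearMap.ext fun v => ?_
  simp only [mul_apply_eq_comp, blockOp_apply, WithLp.toLp_fst, WithLp.toLp_snd, add_apply,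
    map_add]
  congr 2 <;> abel

lemma blockOp_sub (P Q R T P' Q' R' T' : H →L[ℂ] H) :
    blockOp P Q R T - blockOp P' Q' R' T' = blockOp (P - P') (Q - Q') (R - R') (T - T') := by
  refine ContinuousLinearMap.ext fun v => ?_
  simp only [sub_apply, blockOp_apply, ← WithLp.toLp_sub, Prod.mk_sub_mk]
  congr 2 <;> abel

lemma smul_blockOp (a : ℂ) (P Q R T : H →L[ℂ] H) :
    a • blockOp P Q R T = blockOp (a • P) (a • Q) (a • R) (a • T) := by
  refine ContinuousLinearMap.ext fun v => ?_
  simp only [smul_apply, blockOp_apply, ← WithLp.toLp_smul, Prod.smul_mk,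
    smul_add]

lemma blockOp_one : blockOp (1 : H →L[ℂ] H) 0 0 1 = 1 := by
  refine ContinuousLinearMap.ext fun v => ?_
  simp [blockOp_apply]
  rfl

lemma neg_blockOp (P Q R T : H →L[ℂ] H) :
    -blockOp P Q R T = blockOp (-P) (-Q) (-R) (-T) := by
  rw [← neg_one_smul ℂ (blockOp P Q R T), smul_blockOp]
  simp only [neg_one_smul]

lemma norm_blockOp_antidiagonal_le {Q R : H →L[ℂ] H} {C : ℝ} (hQ : ‖Q‖ ≤ C) (hR : ‖R‖ ≤ C) :
    ‖blockOp 0 Q R 0‖ ≤ C := by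
  have hC : 0 ≤ C := (norm_nonneg Q).trans hQ
  refine ContinuousLinearMap.opNorm_le_bound _ hC fun v => ?_
  rw [← sq_le_sq₀ (norm_nonneg _) (by positivity), mul_pow, WithLp.prod_norm_sq_eq_of_L2,
    WithLp.prod_norm_sq_eq_of_L2, blockOp_apply]
  have h1 : ‖Q v.snd‖ ≤ C * ‖v.snd‖ := Q.le_of_opNorm_le hQ _
  have h2 : ‖R v.fst‖ ≤ C * ‖v.fst‖ := R.le_of_opNorm_le hR _
  have h1' := pow_le_pow_left₀ (norm_nonneg _) h1 2
  have h2' := pow_le_pow_left₀ (norm_nonneg _) h2 2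
  simp only [WithLp.toLp_fst, WithLp.toLp_snd, zero_apply, zero_add, add_zero]
  nlinarith

variable [CompleteSpace H]

open ContinuousLinearMap in
lemma adjoint_blockOp (P Q R T : H →L[ℂ] H) :
    adjoint (blockOp P Q R T) = blockOp (adjoint P) (adjoint R) (adjoint Q) (adjoint T) := by
  symm
  rw [eq_adjoint_iff]
  intro v w
  simp only [blockOp_apply, WithLp.prod_inner_apply, inner_add_left, inner_add_right,
    adjoint_inner_left, WithLp.ofLp_fst, WithLp.ofLp_snd]
  abel

lemma norm_le_one_of_star_mul_self {u : Op H} (hu : star u * u = 1) : ‖u‖ ≤ 1 := by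
  have h1 : ‖(1 : Op H)‖ ≤ 1 := ContinuousLinearMap.norm_id_le
  have h2 := CStarRing.norm_star_mul_self (x := u)
  rw [hu] at h2
  nlinarith [norm_nonneg u]

lemma norm_exp_le_one_of_skewAdjoint {x : Op H} (hx : ContinuousLinearMap.adjoint x = -x) (a : ℝ) :
    ‖NormedSpace.exp ((a : ℂ) • x)‖ ≤ 1 := by
  apply norm_le_one_of_star_mul_self
  let _ : NormedAlgebra ℚ (Op H) := NormedAlgebra.restrictScalars ℚ ℂ _
  refine (NormedSpace.exp_mem_unitary_of_mem_skewAdjoint ?_).1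
  rw [skewAdjoint.mem_iff, star_smul, ContinuousLinearMap.star_eq_adjoint, hx, Complex.star_def,
    Complex.conj_ofReal, smul_neg]

lemma mul_exp_mul_of_semiconj {g g' x y : Op H} (hg : g * g' = 1) (h : g * x = y * g) :
    g * NormedSpace.exp x * g' = NormedSpace.exp y := by
  let _ : NormedAlgebra ℚ (Op H) := NormedAlgebra.restrictScalars ℚ ℂ _
  have h2 : SemiconjBy g (NormedSpace.exp x) (NormedSpace.exp y) :=
    SemiconjBy.exp_right (show SemiconjBy g x y from h)
  rw [h2.eq, mul_assoc, hg, mul_one]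

lemma adjoint_one : ContinuousLinearMap.adjoint (1 : H →L[ℂ] H) = 1 := by
  rw [← ContinuousLinearMap.star_eq_adjoint, star_one]

lemma adjoint_I_smul (B : H →L[ℂ] H) : ContinuousLinearMap.adjoint (Complex.I • B) =
    -(Complex.I • ContinuousLinearMap.adjoint B) := by
  rw [← ContinuousLinearMap.star_eq_adjoint, ← ContinuousLinearMap.star_eq_adjoint, star_smul,
    Complex.star_def, Complex.conj_I, neg_smul]

lemma adjoint_gateS :
    ContinuousLinearMap.adjoint (gateS : Op H) = blockOp 1 0 0 (-(Complex.I • 1)) := by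
  rw [gateS, adjoint_blockOp]
  simp only [adjoint_I_smul, adjoint_one, map_zero]

lemma gateS_mul_adjoint : (gateS : Op H) * ContinuousLinearMap.adjoint gateS = 1 := by
  rw [adjoint_gateS, gateS, blockOp_mul, ← blockOp_one]
  simp [smul_smul]

lemma adjoint_gateS_mul : ContinuousLinearMap.adjoint (gateS : Op H) * gateS = 1 := by
  rw [adjoint_gateS, gateS, blockOp_mul, ← blockOp_one]
  simp [smul_smul]

lemma adjoint_gateX : ContinuousLinearMap.adjoint (gateX : Op H) = gateX := by
  rw [gateX, adjoint_blockOp]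
  simp only [adjoint_one, map_zero]

omit [CompleteSpace H] in
lemma gateX_mul_gateX : (gateX : Op H) * gateX = 1 := by
  rw [gateX, blockOp_mul, ← blockOp_one]
  simp

lemma norm_gateS_le : ‖(gateS : Op H)‖ ≤ 1 := norm_le_one_of_star_mul_self adjoint_gateS_mul

lemma norm_adjoint_gateS_le : ‖ContinuousLinearMap.adjoint (gateS : Op H)‖ ≤ 1 := by
  rw [LinearIsometryEquiv.norm_map]; exact norm_gateS_le

lemma norm_gateX_le : ‖(gateX : Op H)‖ ≤ 1 := by
  apply norm_le_one_of_star_mul_self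
  rw [ContinuousLinearMap.star_eq_adjoint, adjoint_gateX, gateX_mul_gateX]

/-- The generator of `S B_A S†`. -/
noncomputable def genFst (A : H →L[ℂ] H) : Op H :=
  blockOp 0 A (-ContinuousLinearMap.adjoint A) 0

/-- The generator of `X B_B X`. -/
noncomputable def genSnd (B : H →L[ℂ] H) : Op H :=
  blockOp 0 (Complex.I • ContinuousLinearMap.adjoint B) (Complex.I • B) 0

lemma gateS_blockEnc (A : H →L[ℂ] H) (a : ℝ) :
    gateS * blockEnc A a * ContinuousLinearMap.adjoint gateS =
      NormedSpace.exp ((a : ℂ) • genFst A) := by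
  refine mul_exp_mul_of_semiconj gateS_mul_adjoint ?_
  rw [genFst, gateS, smul_blockOp, smul_blockOp, blockOp_mul, blockOp_mul]
  congr 1
  · simp
  · simp only [one_mul, mul_zero, zero_add, add_zero, smul_zero, mul_smul_comm, smul_smul, mul_one]
  · simp only [mul_zero, add_zero, zero_add, smul_zero, smul_mul_assoc, smul_smul, mul_one, one_mul]
    rw [← mul_assoc, Complex.I_mul_I, neg_one_mul, neg_smul, smul_neg]
  · simp

lemma gateX_blockEnc (B : H →L[ℂ] H) (a : ℝ) :
    gateX * blockEnc B a * gateX = NormedSpace.exp ((a : ℂ) • genSnd B) := by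
  refine mul_exp_mul_of_semiconj gateX_mul_gateX ?_
  rw [genSnd, gateX, smul_blockOp, smul_blockOp, blockOp_mul, blockOp_mul]
  congr 1 <;> simp [smul_smul, mul_comm]

lemma adjoint_genFst (A : H →L[ℂ] H) : ContinuousLinearMap.adjoint (genFst A) = -genFst A := by
  rw [genFst, adjoint_blockOp, neg_blockOp]
  simp only [map_neg, map_zero, ContinuousLinearMap.adjoint_adjoint, neg_zero, neg_neg]

lemma adjoint_genSnd (B : H →L[ℂ] H) : ContinuousLinearMap.adjoint (genSnd B) = -genSnd B := by
  rw [genSnd, adjoint_blockOp, neg_blockOp]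
  simp only [adjoint_I_smul, map_zero, ContinuousLinearMap.adjoint_adjoint, neg_zero]

lemma norm_genFst_le (A : H →L[ℂ] H) : ‖genFst A‖ ≤ ‖A‖ :=
  norm_blockOp_antidiagonal_le le_rfl (by rw [norm_neg, LinearIsometryEquiv.norm_map])

lemma norm_genSnd_le (B : H →L[ℂ] H) : ‖genSnd B‖ ≤ ‖B‖ :=
  norm_blockOp_antidiagonal_le
    (by rw [norm_smul, Complex.norm_I, one_mul, LinearIsometryEquiv.norm_map])
    (by rw [norm_smul, Complex.norm_I, one_mul])

lemma norm_blockEnc_le (A : H →L[ℂ] H) (a : ℝ) : ‖blockEnc A a‖ ≤ 1 := by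
  have h : blockEnc A a =
      ContinuousLinearMap.adjoint gateS * NormedSpace.exp ((a : ℂ) • genFst A) * gateS := by
    rw [← gateS_blockEnc]
    simp only [mul_assoc]
    rw [adjoint_gateS_mul, mul_one, ← mul_assoc, adjoint_gateS_mul, one_mul]
  rw [h]
  have h1 := norm_exp_le_one_of_skewAdjoint (adjoint_genFst A) a
  calc _ ≤ ‖ContinuousLinearMap.adjoint (gateS : Op H)‖ * ‖NormedSpace.exp ((a : ℂ) • genFst A)‖ *
        ‖(gateS : Op H)‖ :=
        (norm_mul_le _ _).trans (mul_le_mul_of_nonneg_right (norm_mul_le _ _) (norm_nonneg _))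
    _ ≤ 1 * 1 * 1 := by
        gcongr
        exacts [norm_adjoint_gateS_le, norm_gateS_le]
    _ = 1 := by norm_num

lemma blockEnc_mul_neg (A : H →L[ℂ] H) (a : ℝ) : blockEnc A a * blockEnc A (-a) = 1 := by
  rw [blockEnc, blockEnc, Complex.ofReal_neg, mul_neg]
  exact exp_smul_mul_exp_neg_smul _ _

/-- The upper block of the commutator is `i (AB + B†A†)`, which self-adjointness of `AB` makes `2i
AB`; this `2` is the reason for `τ² = t/2`. -/
lemma multTarget_eq {A B : H →L[ℂ] H} (hAB : IsSelfAdjoint (A * B)) {t s : ℝ}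
    (hs : s ^ 2 = t / 2) :
    multTarget A B t =
      NormedSpace.exp ((s : ℂ) ^ 2 • (genFst A * genSnd B - genSnd B * genFst A)) := by
  have h1 : ContinuousLinearMap.adjoint B * ContinuousLinearMap.adjoint A = A * B := by
    have := hAB.star_eq
    rwa [star_mul, ContinuousLinearMap.star_eq_adjoint, ContinuousLinearMap.star_eq_adjoint] at this
  have h2 : ContinuousLinearMap.adjoint (B * A) =
      ContinuousLinearMap.adjoint A * ContinuousLinearMap.adjoint B := by
    rw [← ContinuousLinearMap.star_eq_adjoint, star_mul, ContinuousLinearMap.star_eq_adjoint,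
      ContinuousLinearMap.star_eq_adjoint]
  have hs' : (s : ℂ) ^ 2 = t / 2 := by exact_mod_cast hs
  rw [multTarget, genFst, genSnd, blockOp_mul, blockOp_mul, blockOp_sub, smul_blockOp, smul_blockOp,
    hs', h2]
  congr 2
  · simp only [zero_mul, mul_neg, smul_mul_assoc, mul_smul_comm, h1, zero_add]
    module
  · simp
  · simp
  · simp only [mul_zero, add_zero, neg_mul, mul_smul_comm, smul_mul_assoc]
    module

lemma ApproxEnc.norm_sub_le {U : ℝ → Op H} {A : H →L[ℂ] H} {K c p t₀ ε a : ℝ}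
    (h : ApproxEnc U A K c p t₀) (ha : a ≠ 0) (hat : |a| < t₀) (hK : K * (c * |a|) ^ p ≤ ε / 2)
    (hε : ε ≤ 1) : ‖U a - blockEnc A a‖ ≤ ε := by
  obtain ⟨h1, h2⟩ := h |a| (abs_pos.2 ha) hat
  have h1' := h1.trans hK
  have hε0 : 0 ≤ ε := by linarith [norm_nonneg (U |a| - blockEnc A |a|)]
  rcases lt_or_gt_of_ne ha with hneg | hpos
  · rw [abs_of_neg hneg] at h1' h2 hK
    rw [neg_neg] at h2
    rcases h2 with ⟨h3, -⟩ | h3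
    · have := blockEnc_mul_neg A (-a)
      rw [neg_neg] at this
      exact norm_inv_sub_inv_le hε h3 this (norm_blockEnc_le A a) h1'
    · linarith
  · rw [abs_of_pos hpos] at h1'
    linarith

end Blocks

/-- Needed because `ApproxEnc` says nothing about time `0`. -/
lemma time_ne_zero_of_mem_bchWord {p : ℕ} {t : ℝ} (ht : t ≠ 0) :
    ∀ x ∈ bchWord p t, x.2 ≠ 0 := by
  induction p generalizing t with
  | zero => simp [bchWord]
  | succ p ih =>
    cases p with
    | zero =>
      intro x hx
      simp only [bchWord, List.mem_cons, List.not_mem_nil, or_false] at hx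
      rcases hx with rfl | rfl | rfl | rfl <;> simpa using ht
    | succ p =>
      intro x hx
      have hγ : bchGamma (p + 1) * t ≠ 0 := mul_ne_zero (bchGamma_pos (by omega)).ne' ht
      have hβ : bchBeta (p + 1) * t ≠ 0 := mul_ne_zero (bchBeta_pos (by omega)).ne' ht
      simp only [bchWord, ExpWord.inv, List.mem_append, List.mem_map, List.mem_reverse] at hx
      rcases hx with ((((h | h) | ⟨y, h, rfl⟩) | ⟨y, h, rfl⟩) | h) | h
      · exact ih hγ x h
      · exact ih (neg_ne_zero.2 hγ) x h
      · exact neg_ne_zero.2 (ih hβ y h)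
      · exact neg_ne_zero.2 (ih (neg_ne_zero.2 hβ) y h)
      · exact ih hγ x h
      · exact ih (neg_ne_zero.2 hγ) x h

lemma one_le_multOrder (pA pB : ℝ) : 1 ≤ multOrder pA pB := le_max_right _ _

lemma min_le_two_mul_multOrder (pA pB : ℝ) :
    min pA pB ≤ ((2 * multOrder pA pB + 1 : ℕ) : ℝ) := by
  have h1 : (min pA pB - 1) / 2 ≤ (⌈(min pA pB - 1) / 2⌉₊ : ℝ) := Nat.le_ceil _
  have h2 : (⌈(min pA pB - 1) / 2⌉₊ : ℝ) ≤ (multOrder pA pB : ℝ) := by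
    exact_mod_cast le_max_left _ _
  push_cast
  linarith

/-! ### The error of `MULT` -/

section Estimate

variable {H : Type*} [NormedAddCommGroup H] [InnerProductSpace ℂ H] [CompleteSpace H]

lemma norm_conj_sub_le {g g' u b : Op H} (hg : ‖g‖ ≤ 1) (hg' : ‖g'‖ ≤ 1) {ε : ℝ}
    (h : ‖u - b‖ ≤ ε) : ‖g * u * g' - g * b * g'‖ ≤ ε := by
  have hε : 0 ≤ ε := (norm_nonneg _).trans h
  calc ‖g * u * g' - g * b * g'‖ = ‖g * (u - b) * g'‖ := by rw [mul_sub, sub_mul]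
    _ ≤ ‖g‖ * ‖u - b‖ * ‖g'‖ :=
        (norm_mul_le _ _).trans (mul_le_mul_of_nonneg_right (norm_mul_le _ _) (norm_nonneg _))
    _ ≤ 1 * ε * 1 := by gcongr
    _ = ε := by ring

/-- The error of one approximate exponential in the word of `MULT`. -/
lemma ApproxEnc.norm_sub_le_of_bound {U : ℝ → Op H} {A : H →L[ℂ] H} {K K₀ c C p m t₀ L s a : ℝ}
    (h : ApproxEnc U A K c p t₀) (hK : K ≤ K₀) (hK₀ : 0 ≤ K₀) (hc : 0 ≤ c) (hcC : c ≤ C)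
    (hm : 0 ≤ m) (hmp : m ≤ p) (ha : a ≠ 0) (haL : |a| ≤ L * s) (hLt : L * s < t₀)
    (hx1 : L * C * s ≤ 1) (hε : 2 * K₀ * (L * C * s) ^ m ≤ 1) :
    ‖U a - blockEnc A a‖ ≤ 2 * K₀ * (L * C * s) ^ m := by
  refine h.norm_sub_le ha (haL.trans_lt hLt) ?_ hε
  have h0 : 0 ≤ c * |a| := by positivity
  have hC : 0 ≤ C := hc.trans hcC
  have h1 : c * |a| ≤ L * C * s := by
    calc c * |a| ≤ C * (L * s) := by gcongr
      _ = _ := by ring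
  have hx0 : 0 ≤ L * C * s := h0.trans h1
  calc K * (c * |a|) ^ p ≤ K₀ * (c * |a|) ^ p := by gcongr
    _ ≤ K₀ * (L * C * s) ^ p := by
        have := hm.trans hmp
        gcongr
    _ ≤ K₀ * (L * C * s) ^ m :=
        mul_le_mul_of_nonneg_left (Real.rpow_le_rpow_of_exponent_ge' hx0 hx1 hm hmp) hK₀
    _ = _ := by ring

/-- The error of `MULT`, in terms of the small parameter `L C τ`. -/
theorem norm_mult_sub_multTarget_le {A B : H →L[ℂ] H} (hAB : IsSelfAdjoint (A * B))
    {UA UB : ℝ → Op H} {pA pB KA KB K₀ c C t₀ L t : ℝ} (hpA : 1 ≤ pA) (hpB : 1 ≤ pB)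
    (hKA : KA ≤ K₀) (hKB : KB ≤ K₀) (hK₀ : 0 ≤ K₀) (hc : 0 ≤ c) (hcC : c ≤ C)
    (hA : ‖A‖ ≤ C) (hB : ‖B‖ ≤ C) (hUA : ApproxEnc UA A KA c pA t₀)
    (hUB : ApproxEnc UB B KB c pB t₀) (ht : 0 < t)
    (hL : (bchWord (multOrder pA pB) 1).duration ≤ L) (hL2 : 2 ≤ L)
    (hLt : L * √(t / 2) < t₀) (hx1 : L * C * √(t / 2) ≤ 1 / 2)
    (hε : 2 * K₀ * (L * C * √(t / 2)) ≤ 1) :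
    ‖mult UA UB pA pB t - multTarget A B t‖ ≤
      (2 ^ (bchWord (multOrder pA pB) 1).length * (2 * K₀) + 4) *
        (L * C * √(t / 2)) ^ min pA pB := by
  set q := multOrder pA pB with hq
  set s := √(t / 2) with hs
  set m := min pA pB with hm
  have hs0 : 0 < s := Real.sqrt_pos.2 (by positivity)
  have hssq : s ^ 2 = t / 2 := Real.sq_sqrt (by positivity)
  have hm1 : 1 ≤ m := le_min hpA hpB
  have hC : 0 ≤ C := hc.trans hcC
  have hx0 : 0 ≤ L * C * s := by positivity
  -- As `m ≥ 1` and the base is at most `1`, the linear smallness assumption already forces `ε ≤ 1`.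
  have hxm : (L * C * s) ^ m ≤ L * C * s := by
    have := Real.rpow_le_rpow_of_exponent_ge' hx0 (by linarith) zero_le_one hm1
    rwa [Real.rpow_one] at this
  set ε := 2 * K₀ * (L * C * s) ^ m with hεdef
  have hε0 : 0 ≤ ε := by positivity
  have hε1 : ε ≤ 1 := (mul_le_mul_of_nonneg_left hxm (by positivity)).trans hε
  have h1 : ‖(1 : Op H)‖ ≤ 1 := ContinuousLinearMap.norm_id_le
  have hword : bchWord q s = (bchWord q 1).scale s := by rw [← bchWord_scale, mul_one]
  have htime : ∀ x ∈ bchWord q s, |x.2| ≤ L * s := by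
    intro x hx
    rw [hword, ExpWord.scale, List.mem_map] at hx
    obtain ⟨y, hy, rfl⟩ := hx
    rw [abs_mul, abs_of_pos hs0, mul_comm]
    exact mul_le_mul_of_nonneg_right ((ExpWord.abs_le_duration hy).trans hL) hs0.le
  have hne := time_ne_zero_of_mem_bchWord (p := q) hs0.ne'
  have hpert := (ExpWord.norm_run_sub_run_le h1 hε0 hε1
    (U' := fun a => gateS * UA a * ContinuousLinearMap.adjoint gateS)
    (V' := fun a => gateX * UB a * gateX)
    (norm_exp_le_one_of_skewAdjoint (adjoint_genFst A))
    (norm_exp_le_one_of_skewAdjoint (adjoint_genSnd B)) (bchWord q s)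
    (fun x hx => by
      rw [← gateS_blockEnc]
      exact norm_conj_sub_le norm_gateS_le norm_adjoint_gateS_le
        (hUA.norm_sub_le_of_bound hKA hK₀ hc hcC (by linarith) (min_le_left _ _) (hne x hx)
          (htime x hx) hLt (by linarith) hε1))
    (fun x hx => by
      rw [← gateX_blockEnc]
      exact norm_conj_sub_le norm_gateX_le norm_gateX_le
        (hUB.norm_sub_le_of_bound hKB hK₀ hc hcC (by linarith) (min_le_right _ _) (hne x hx)
          (htime x hx) hLt (by linarith) hε1))).1
  have hexact := norm_bchWord_sub_exp_le h1 ((norm_genFst_le A).trans hA)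
    ((norm_genSnd_le B).trans hB) (one_le_multOrder pA pB) hL hL2 hs0.le hx1
  rw [← multTarget_eq hAB hssq] at hexact
  have hpow : (L * C * s) ^ (2 * q + 1) ≤ (L * C * s) ^ m := by
    rw [← Real.rpow_natCast]
    exact Real.rpow_le_rpow_of_exponent_ge' hx0 (by linarith) (by linarith)
      (min_le_two_mul_multOrder pA pB)
  have hlen : (bchWord q s).length = (bchWord q 1).length := by
    rw [hword, ExpWord.scale, List.length_map]
  rw [hlen] at hpert
  have htri := norm_sub_le_norm_sub_add_norm_sub (mult UA UB pA pB t)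
    ((bchWord q s).run (fun a => NormedSpace.exp ((a : ℂ) • genFst A))
      (fun a => NormedSpace.exp ((a : ℂ) • genSnd B))) (multTarget A B t)
  refine htri.trans ((add_le_add hpert hexact).trans ?_)
  calc (2 ^ (bchWord q 1).length - 1) * ε + 4 * (L * C * s) ^ (2 * q + 1)
      ≤ 2 ^ (bchWord q 1).length * ε + 4 * (L * C * s) ^ m := by
        gcongr
        linarith
    _ = _ := by rw [hεdef]; ring

end Estimate

/-! ### Gate count and choice of constants -/

lemma length_multWord_le (pA pB t : ℝ) :
    (multWord pA pB t).length ≤ 8 * 6 ^ (multOrder pA pB - 1) := by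
  obtain ⟨k, hk⟩ : ∃ k, multOrder pA pB = k + 1 :=
    ⟨multOrder pA pB - 1, by have := one_le_multOrder pA pB; omega⟩
  rw [multWord, hk, length_bchWord, Nat.add_sub_cancel]
  exact Nat.mul_le_mul_right _ (by norm_num)

end HybridMult

theorem mainTheorem5 (pA pB : ℝ) (hpA : 1 ≤ pA) (hpB : 1 ≤ pB) (KA KB : ℝ) :
    (∀ t : ℝ, (HybridMult.multWord pA pB t).length ≤
      8 * 6 ^ (HybridMult.multOrder pA pB - 1)) ∧
    ∃ K δ : ℝ, 0 < δ ∧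
      ∀ (H : Type*) [NormedAddCommGroup H] [InnerProductSpace ℂ H] [CompleteSpace H]
        (A B : H →L[ℂ] H), IsSelfAdjoint (A * B) →
      ∀ (c : ℝ), 0 ≤ c → ∀ (t₀ : ℝ), 0 < t₀ →
      ∀ (UA UB : ℝ → HybridMult.Op H),
        HybridMult.ApproxEnc UA A KA c pA t₀ →
        HybridMult.ApproxEnc UB B KB c pB t₀ →
      ∀ (t : ℝ), 0 < t → t ≤ δ * t₀ ^ 2 → (max (max ‖A‖ ‖B‖) c) ^ 2 * t ≤ δ →
        ‖HybridMult.mult UA UB pA pB t - HybridMult.multTarget A B t‖ ≤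
          K * ((max (max ‖A‖ ‖B‖) c) ^ 2 * t) ^ (min pA pB / 2) := by
  refine ⟨HybridMult.length_multWord_le pA pB, ?_⟩
  set w := HybridMult.bchWord (HybridMult.multOrder pA pB) 1
  set L := w.duration + 2 with hLdef
  -- Absolute values, since `KA` and `KB` may be negative.
  set K₀ := |KA| + |KB| with hK₀def
  have hK₀ : 0 ≤ K₀ := by positivity
  have hL2 : 2 ≤ L := by have := w.duration_nonneg; linarith
  -- With `δ = r²`, the hypotheses on `t` give `C τ ≤ r` and `τ ≤ r t₀`; the identity `L r (1 + K₀)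
  -- = 1/2` then yields `L C τ ≤ 1/2`, `2 K₀ L C τ ≤ 1` and `L τ < t₀` at once.
  set r := (2 * L * (1 + K₀))⁻¹ with hr
  have hr0 : 0 < r := by positivity
  have hrL : L * r * (1 + K₀) = 1 / 2 := by rw [hr]; field_simp
  have hLr : L * r ≤ 1 / 2 := by
    have h1 : 0 < L * r := by positivity
    nlinarith
  refine ⟨(2 ^ w.length * (2 * K₀) + 4) * L ^ min pA pB, r ^ 2, by positivity, ?_⟩
  intro H _ _ _ A B hAB c hc t₀ ht₀ UA UB hUA hUB t ht htt₀ hCt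
  set C := max (max ‖A‖ ‖B‖) c
  have hcC : c ≤ C := le_max_right _ _
  have hC : 0 ≤ C := hc.trans hcC
  have hs : √(t / 2) ≤ √t := Real.sqrt_le_sqrt (by linarith)
  have hCs : C * √t = √(C ^ 2 * t) := by
    rw [Real.sqrt_mul (by positivity), Real.sqrt_sq hC]
  have hCr : C * √(t / 2) ≤ r := by
    calc C * √(t / 2) ≤ C * √t := by gcongr
      _ = √(C ^ 2 * t) := hCs
      _ ≤ √(r ^ 2) := Real.sqrt_le_sqrt hCt
      _ = r := Real.sqrt_sq hr0.le
  have htr : √(t / 2) ≤ r * t₀ := by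
    calc √(t / 2) ≤ √t := hs
      _ ≤ √(r ^ 2 * t₀ ^ 2) := Real.sqrt_le_sqrt htt₀
      _ = r * t₀ := by rw [← mul_pow, Real.sqrt_sq (by positivity)]
  have hx : L * C * √(t / 2) ≤ L * r := by
    rw [mul_assoc]; gcongr
  have hLt : L * √(t / 2) < t₀ := by
    calc L * √(t / 2) ≤ L * (r * t₀) := by gcongr
      _ = L * r * t₀ := by ring
      _ ≤ 1 / 2 * t₀ := by gcongr
      _ < t₀ := by linarith
  have hε : 2 * K₀ * (L * C * √(t / 2)) ≤ 1 := by
    calc 2 * K₀ * (L * C * √(t / 2)) ≤ 2 * K₀ * (L * r) := by gcongr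
      _ ≤ 2 * (L * r * (1 + K₀)) := by
        have : 0 ≤ L * r := by positivity
        linarith
      _ = 1 := by rw [hrL]; norm_num
  have hKA : KA ≤ K₀ := (le_abs_self KA).trans (le_add_of_nonneg_right (abs_nonneg _))
  have hKB : KB ≤ K₀ := (le_abs_self KB).trans (le_add_of_nonneg_left (abs_nonneg _))
  have hA : ‖A‖ ≤ C := (le_max_left _ _).trans (le_max_left _ _)
  have hB : ‖B‖ ≤ C := (le_max_right _ _).trans (le_max_left _ _)
  have hL : w.duration ≤ L := by linarith
  refine (HybridMult.norm_mult_sub_multTarget_le hAB hpA hpB hKA hKB hK₀ hc hcC hA hB hUA hUB ht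
    hL hL2 hLt (hx.trans hLr) hε).trans ?_
  have hm : 0 ≤ min pA pB := by have := le_min hpA hpB; linarith
  rw [mul_assoc (2 ^ w.length * (2 * K₀) + 4)]
  refine mul_le_mul_of_nonneg_left ?_ (by positivity)
  calc (L * C * √(t / 2)) ^ min pA pB ≤ (L * √(C ^ 2 * t)) ^ min pA pB := by
        apply Real.rpow_le_rpow (by positivity) _ hm
        rw [← hCs, mul_assoc]
        gcongr
    _ = L ^ min pA pB * (C ^ 2 * t) ^ (min pA pB / 2) := by
        rw [Real.mul_rpow (by positivity) (by positivity), Real.sqrt_eq_rpow,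
          ← Real.rpow_mul (by positivity)]
        congr 2
        ring
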